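/- **Setting.** Let $d\ge 1$, $\tau\in(0,1)$, $\rho_\tau(u)=|\tau-\mathbf 1(u<0)|\,u^2$ (expectile loss) and $\psi_\tau(u)=2(\mathbf 1(u\le 0)-\tau)|u|$. Let $(X_i,Y_i)$, $i\ge 1$, be i.i.d. in $\mathbb R^d\times\mathbb R$ with $Y_i=\theta_0(X_i)+\varepsilon_i$, where $X_i$ has density $f_X$, $\varepsilon_i$ given $X_i=x$ has density $f_{\varepsilon|X}(\cdot|x)$ with distribution function $F_{\varepsilon|X}(\cdot|x)$, and the conditional $\tau$-expectile of $\varepsilon_i$ given $X_i=x$ is $0$ (i.e. $\int|v|f_{\varepsilon|X}(v|x)\,dv<\infty$ and $\int\psi_\tau(v)f_{\varepsilon|X}(v|x)\,dv=0$) whenever $f_X(x)>0$. Let $K:\mathbb R^d\to\mathbb R$ be integrable with $\int K=1$, let $h=h_n>0$, write $K_h(u)=h^{-d}K(u/h)$ (and similarly $L_{\bar h}$), and let $\hat\theta_n(x)$ be a minimizer of $t\mapsto n^{-1}\sum_{i=1}^n K_h(x-X_i)\rho_\tau(Y_i-t)$ whenever one exists; $\hat\varepsilon_i=Y_i-\hat\theta_n(X_i)$.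 Let $\mathcal D\subset\mathbb R^d$ be compact. Given $L,G,g$ and bandwidths $h_0=h_{0,n}>0$, $\bar h=\bar h_n>0$, put $$\hat f_X(x)=\frac1n\sum_{i=1}^n L_{\bar h}(x-X_i),\qquad \hat\sigma^2(x)=\frac{n^{-1}\sum_{i=1}^n\psi_\tau^2(\hat\varepsilon_i)L_{\bar h}(x-X_i)}{\hat f_X(x)} .$$ Given the data, the bootstrap pairs $(X_i^*,\varepsilon_i^*)$, $i=1,\dots,n$, are i.i.d. with density $$\hat f_{\varepsilon,X}(v,x)=\frac1n\sum_{i=1}^n h_0^{-1}g\Big(\frac{\hat\varepsilon_i-v}{h_0}\Big)L_{\bar h}(x-X_i);$$ $P^*,E^*$ are probability and expectation under this law given the data, and $$\sigma_*^2(x)=E^*[\psi_\tau(\varepsilon^*)^2\mid X^*=x]=\frac{\int\psi_\tau^2(v)\hat f_{\varepsilon,X}(v,x)\,dv}{\int\hat f_{\varepsilon,X}(v,x)\,dv}$$ (with $0/0=0$ in both variances, at points where $\hat f_X(x)=0$). **Assumptions.** * (B1) $L$ is a Lipschitz, bounded, symmetric probability density on $\mathbb R^d$. $G$ is a Lipschitz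 distribution function on $\mathbb R$ whose derivative $g$ is a Lipschitz, bounded, symmetric, five times continuously differentiable probability density with $\int v^2g(v)\,dv<\infty$. * (B2) $s'>\max\{2,d\}$. For each $x\in\mathcal D$, $F_{\varepsilon|X}(\cdot|x)$ is in the Hölder class of order $s'+1$; for each $v$, $F_{\varepsilon|X}(v|\cdot)$ is continuous on $\mathcal D$; $f_X$ is in the Hölder class of order $2$; $x\mapsto E[\psi_\tau^2(\varepsilon_i)\mid X_i=x]$ is finite and twice continuously differentiable on $\mathcal D$. (Hölder class of order $r$: $m$ times continuously differentiable, with $(r-m)$-Hölder continuous $m$-th derivative, $m$ the largest integer $<r$.) * (B3) $nh_0\bar h^d\to\infty$ and $h_0,\bar h=O(n^{-\nu})$ for some $\nu>0$. * (EC1) $\sup_{x\in\mathcal D}\int|v|^b f_{\varepsilon|X}(v|x)\,dv<\infty$. **Lemma 3.2.** Assume (B1)–(B3), and (EC1) with $b>2(2s'+d+1)/(2s'+3)$. Then $$\sup_{x\in\mathcal D}\big|\sigma_*^2(x)-\hat\sigma^2(x)\big|=o_p^*\big((\log n)^{-1/2}\big)\quad\text{almost surely},$$ that is, for almost every realization of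 the data, $P^*\big(\sup_{x\in\mathcal D}|\sigma_*^2(x)-\hat\sigma^2(x)|>\delta(\log n)^{-1/2}\big)\to0$ for every $\delta>0$. Moreover, $\sigma_*$ may be replaced by $\hat\sigma$ in the bootstrap limit theorem, in the following sense. Suppose that $K$ is continuously differentiable with compact support and let $\kappa>0$. Put $\hat F_{\varepsilon|X}(0|x)=n^{-1}\sum_{i=1}^n G(-\hat\varepsilon_i/h_0)L_{\bar h}(x-X_i)/\hat f_X(x)$, $\hat S(x)=2\{\tau-\hat F_{\varepsilon|X}(0|x)(2\tau-1)\}\hat f_X(x)$, $A_n^*(x)=n^{-1}\sum_{i=1}^n K_h(x-X_i^*)\psi_\tau(\varepsilon_i^*)$, $\hat\theta^*(x)-\hat\theta_n(x)=\hat S(x)^{-1}\{A_n^*(x)-E^*A_n^*(x)\}$, $\Sigma=(\int\partial_iK\,\partial_jK)_{i,j}$, $H_2=(2\pi\|K\|_2^2)^{-d/2}\det(\Sigma)^{1/2}$ and $$d_n=(2d\kappa\log n)^{1/2}+(2d\kappa\log n)^{-1/2}\Big[\tfrac12(d-1)\log\log n^\kappa+\log\{(2\pi)^{-1/2}H_2(2d)^{(d-1)/2}\}\Big].$$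 Then for almost every realization of the data along which $\hat\sigma^2$ is eventually bounded away from $0$ on $\mathcal D$, the statement $$P^*\Big\{(2d\kappa\log n)^{1/2}\Big(\sup_{x\in\mathcal D}\sqrt{\tfrac{nh^d}{\hat f_X(x)V_n(x)}}\;\hat S(x)\,|\hat\theta^*(x)-\hat\theta_n(x)|\big/\|K\|_2-d_n\Big)<a\Big\}\to\exp\{-2e^{-a}\}\quad\text{for all }a\in\mathbb R$$ holds with $V_n=\sigma_*^2$ if and only if it holds with $V_n=\hat\sigma^2$. -/

import Mathlib

open MeasureTheory ProbabilityTheory Filter Topology Asymptotics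
open scoped ENNReal NNReal

noncomputable section

namespace ExpectileBoot

/-- The covariate space `ℝ^d` with its Euclidean norm and Lebesgue measure. -/
abbrev Vec (d : ℕ) : Type := EuclideanSpace ℝ (Fin d)

/-! ### Loss function and local constant estimator -/

/-- The expectile loss `ρ_τ(u) = |τ - 1(u < 0)| |u|²`. -/
def rho (τ u : ℝ) : ℝ := |τ - (if u < 0 then 1 else 0)| * |u| ^ 2

/-- The expectile score `ψ_τ(u) = 2 (1(u ≤ 0) - τ) |u|`. -/
def psi (τ u : ℝ) : ℝ := 2 * ((if u ≤ 0 then 1 else 0) - τ) * |u|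

/-- The rescaled kernel `K_h(u) = h^{-d} K(u / h)`. -/
def scaled {d : ℕ} (K : Vec d → ℝ) (h : ℝ) (u : Vec d) : ℝ := (h ^ d)⁻¹ * K (h⁻¹ • u)

/-- The local constant criterion `t ↦ n⁻¹ ∑_{i ≤ n} K_h(x - X_i) ρ_τ(Y_i - t)`. -/
def localLoss {d : ℕ} (τ : ℝ) (K : Vec d → ℝ) (h : ℝ) (n : ℕ) (xs : ℕ → Vec d) (ys : ℕ → ℝ)
    (x : Vec d) (t : ℝ) : ℝ :=
  (n : ℝ)⁻¹ * ∑ i ∈ Finset.range n, scaled K h (x - xs i) * rho τ (ys i - t)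

/-- `θhat n ω x` is a point of `argmin_t n⁻¹ ∑ K_h(x - X_i) ρ_τ(Y_i - t)` (any one, if there are
several; nothing is required at the arguments where the criterion has no minimizer, which can
happen when `K` takes negative values). -/
def IsLocalExpectile {d : ℕ} {Ω : Type*} (τ : ℝ) (K : Vec d → ℝ) (h : ℕ → ℝ)
    (X : ℕ → Ω → Vec d) (Y : ℕ → Ω → ℝ) (θhat : ℕ → Ω → Vec d → ℝ) : Prop :=
  ∀ n ω x,
    (∃ t, ∀ t', localLoss τ K (h n) n (fun i => X i ω) (fun i => Y i ω) x t
        ≤ localLoss τ K (h n) n (fun i => X i ω) (fun i => Y i ω) x t') →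
    ∀ t', localLoss τ K (h n) n (fun i => X i ω) (fun i => Y i ω) x (θhat n ω x)
        ≤ localLoss τ K (h n) n (fun i => X i ω) (fun i => Y i ω) x t'

/-- The residuals `Y_i - θhat_n(X_i)` at sample size `n`. -/
def resid {d : ℕ} {Ω : Type*} (X : ℕ → Ω → Vec d) (Y : ℕ → Ω → ℝ) (θhat : ℕ → Ω → Vec d → ℝ)
    (n : ℕ) (ω : Ω) (i : ℕ) : ℝ := Y i ω - θhat n ω (X i ω)

/-! ### The regression model -/

/-- `(X_i, Y_i)` are i.i.d. with `Y_i = θ₀(X_i) + ε_i`; here `fX` is the density of `X_i`,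
`fε v x` is the conditional density at `v` of `ε_i` given `X_i = x`, and the `τ`-expectile of this
conditional distribution is `0`, that is, `θ₀` is the conditional `τ`-expectile of `Y_i`. -/
structure IsExpectileModel {d : ℕ} {Ω : Type*} [MeasurableSpace Ω] (μ : Measure Ω) (τ : ℝ)
    (X : ℕ → Ω → Vec d) (Y : ℕ → Ω → ℝ) (θ₀ : Vec d → ℝ) (fX : Vec d → ℝ)
    (fε : ℝ → Vec d → ℝ) : Prop where
  measurable_X : ∀ i, Measurable (X i)
  measurable_Y : ∀ i, Measurable (Y i)
  measurable_θ₀ : Measurable θ₀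
  measurable_fX : Measurable fX
  fX_nonneg : ∀ x, 0 ≤ fX x
  measurable_fε : Measurable (fun p : Vec d × ℝ => fε p.2 p.1)
  fε_nonneg : ∀ v x, 0 ≤ fε v x
  lintegral_fε : ∀ x, ∫⁻ v, ENNReal.ofReal (fε v x) = 1
  indep : iIndepFun (fun i ω => (X i ω, Y i ω)) μ
  law : ∀ i, μ.map (fun ω => (X i ω, Y i ω)) = (volume : Measure (Vec d × ℝ)).withDensity
    (fun p => ENNReal.ofReal (fX p.1 * fε (p.2 - θ₀ p.1) p.1))
  expectile : ∀ x, 0 < fX x →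
    Integrable (fun v => v * fε v x) ∧ ∫ v, psi τ v * fε v x = 0

/-! ### Assumptions -/

/-- The Hölder class of real order `r > 0`: with `m` the largest integer strictly below `r`, the
function is `m` times continuously differentiable and its `m`-th derivative is Hölder continuous
with exponent `r - m`. -/
def IsHolder {E F : Type*} [NormedAddCommGroup E] [NormedSpace ℝ E] [NormedAddCommGroup F]
    [NormedSpace ℝ F] (r : ℝ) (f : E → F) : Prop :=
  ContDiff ℝ ((⌈r⌉₊ - 1 : ℕ) : WithTop ℕ∞) f ∧
    ∃ C : ℝ≥0, HolderWith C (r - ((⌈r⌉₊ - 1 : ℕ) : ℝ)).toNNReal (iteratedFDeriv ℝ (⌈r⌉₊ - 1) f)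

/-- The smoothing kernels: `L` is a symmetric, bounded, Lipschitz probability density on `ℝ^d`;
`G` is a Lipschitz cdf whose derivative `g` is a symmetric, bounded, Lipschitz, five times
continuously differentiable probability density. The last field says that `g` has a finite second
moment, which is what makes the bootstrap variance finite. -/
structure KernelAssumption {d : ℕ} (L : Vec d → ℝ) (G g : ℝ → ℝ) : Prop where
  L_nonneg : ∀ u, 0 ≤ L u
  L_integrable : Integrable L
  L_integral : ∫ u, L u = 1
  L_symm : ∀ u, L (-u) = L u
  L_bdd : ∃ C, ∀ u, L u ≤ C
  L_lip : ∃ C : ℝ≥0, LipschitzWith C L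
  G_mono : Monotone G
  G_atBot : Tendsto G atBot (𝓝 0)
  G_atTop : Tendsto G atTop (𝓝 1)
  G_lip : ∃ C : ℝ≥0, LipschitzWith C G
  G_deriv : ∀ v, HasDerivAt G (g v) v
  g_nonneg : ∀ v, 0 ≤ g v
  g_integrable : Integrable g
  g_integral : ∫ v, g v = 1
  g_symm : ∀ v, g (-v) = g v
  g_bdd : ∃ C, ∀ v, g v ≤ C
  g_lip : ∃ C : ℝ≥0, LipschitzWith C g
  g_smooth : ContDiff ℝ 5 g
  g_second_moment : Integrable (fun v => v ^ 2 * g v)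

/-- The conditional distribution function of the error. -/
def condCdf {d : ℕ} (fε : ℝ → Vec d → ℝ) (v : ℝ) (x : Vec d) : ℝ := ∫ u in Set.Iic v, fε u x

/-- The conditional variance `σ²(x) = E[ψ_τ(ε)² | X = x]`. -/
def sigmaSq {d : ℕ} (τ : ℝ) (fε : ℝ → Vec d → ℝ) (x : Vec d) : ℝ := ∫ v, psi τ v ^ 2 * fε v x

/-- Smoothness of the model, with smoothness index `s'`. -/
structure SmoothnessAssumption {d : ℕ} (τ s' : ℝ) (D : Set (Vec d)) (fX : Vec d → ℝ)
    (fε : ℝ → Vec d → ℝ) : Prop where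
  index : max 2 (d : ℝ) < s'
  cdf_holder : ∀ x ∈ D, IsHolder (s' + 1) (fun v => condCdf fε v x)
  cdf_cont : ∀ v, ContinuousOn (fun x => condCdf fε v x) D
  fX_holder : IsHolder 2 fX
  sigma_finite : ∀ x ∈ D, Integrable (fun v => psi τ v ^ 2 * fε v x)
  sigma_smooth : ContDiffOn ℝ 2 (sigmaSq τ fε) D

/-- The smoothing bandwidths: `n h₀ hbar^d → ∞` and `h₀, hbar = O(n^{-ν})` for some `ν > 0`. -/
structure BandwidthAssumption (d : ℕ) (h₀ hbar : ℕ → ℝ) : Prop where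
  h₀_pos : ∀ n, 0 < h₀ n
  hbar_pos : ∀ n, 0 < hbar n
  tendsto : Tendsto (fun n : ℕ => (n : ℝ) * h₀ n * hbar n ^ d) atTop atTop
  rate : ∃ ν : ℝ, 0 < ν ∧ h₀ =O[atTop] (fun n : ℕ => (n : ℝ) ^ (-ν)) ∧
    hbar =O[atTop] (fun n : ℕ => (n : ℝ) ^ (-ν))

/-- The conditional absolute moments of order `b` are bounded over `D`. -/
def MomentAssumption {d : ℕ} (b : ℝ) (D : Set (Vec d)) (fε : ℝ → Vec d → ℝ) : Prop :=
  (⨆ x ∈ D, ∫⁻ v, ENNReal.ofReal (|v| ^ b * fε v x)) < ⊤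

/-! ### Residual-based estimators

The arguments `xs` and `es` are the observed covariates and the residuals; only the first `n` of
each are used. -/

/-- `fhat_X(x) = n⁻¹ ∑ L_hbar(x - X_i)`. -/
def fXHat {d : ℕ} (L : Vec d → ℝ) (hbar : ℝ) (n : ℕ) (xs : ℕ → Vec d) (x : Vec d) : ℝ :=
  (n : ℝ)⁻¹ * ∑ i ∈ Finset.range n, scaled L hbar (x - xs i)

/-- `Fhat_{ε|X}(v|x) = n⁻¹ ∑ G((v - εhat_i)/h₀) L_hbar(x - X_i) / fhat_X(x)`. -/
def condCdfHat {d : ℕ} (L : Vec d → ℝ) (G : ℝ → ℝ) (h₀ hbar : ℝ) (n : ℕ) (xs : ℕ → Vec d)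
    (es : ℕ → ℝ) (v : ℝ) (x : Vec d) : ℝ :=
  ((n : ℝ)⁻¹ * ∑ i ∈ Finset.range n, G ((v - es i) / h₀) * scaled L hbar (x - xs i)) /
    fXHat L hbar n xs x

/-- `σhat²(x) = n⁻¹ ∑ ψ_τ(εhat_i)² L_hbar(x - X_i) / fhat_X(x)`. -/
def sigmaHatSq {d : ℕ} (τ : ℝ) (L : Vec d → ℝ) (hbar : ℝ) (n : ℕ) (xs : ℕ → Vec d)
    (es : ℕ → ℝ) (x : Vec d) : ℝ :=
  ((n : ℝ)⁻¹ * ∑ i ∈ Finset.range n, psi τ (es i) ^ 2 * scaled L hbar (x - xs i)) /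
    fXHat L hbar n xs x

/-! ### The bootstrap -/

/-- The resampling density `fhat_{ε,X}(v, x) = n⁻¹ ∑ g_{h₀}(εhat_i - v) L_hbar(x - X_i)`. -/
def jointHat {d : ℕ} (L : Vec d → ℝ) (g : ℝ → ℝ) (h₀ hbar : ℝ) (n : ℕ) (xs : ℕ → Vec d)
    (es : ℕ → ℝ) (v : ℝ) (x : Vec d) : ℝ :=
  (n : ℝ)⁻¹ * ∑ i ∈ Finset.range n, h₀⁻¹ * g ((es i - v) / h₀) * scaled L hbar (x - xs i)

/-- The law of one bootstrap pair `(X*, ε*)` given the data. -/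
def bootPairLaw {d : ℕ} (L : Vec d → ℝ) (g : ℝ → ℝ) (h₀ hbar : ℝ) (n : ℕ) (xs : ℕ → Vec d)
    (es : ℕ → ℝ) : Measure (Vec d × ℝ) :=
  (volume : Measure (Vec d × ℝ)).withDensity
    (fun p => ENNReal.ofReal (jointHat L g h₀ hbar n xs es p.2 p.1))

/-- The bootstrap probability `P*`: the law of the bootstrap sample
`(X*_i, ε*_i)`, `i = 1, …, n`, given the data. -/
def bootLaw {d : ℕ} (L : Vec d → ℝ) (g : ℝ → ℝ) (h₀ hbar : ℝ) (n : ℕ) (xs : ℕ → Vec d)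
    (es : ℕ → ℝ) : Measure (Fin n → Vec d × ℝ) :=
  Measure.pi (fun _ => bootPairLaw L g h₀ hbar n xs es)

/-- The bootstrap conditional variance `σ_*²(x) = E*[ψ_τ(ε*)² | X* = x]`, the mean of `ψ_τ²` under
the conditional density of `ε*` given `X* = x`. -/
def sigmaStarSq {d : ℕ} (τ : ℝ) (L : Vec d → ℝ) (g : ℝ → ℝ) (h₀ hbar : ℝ) (n : ℕ)
    (xs : ℕ → Vec d) (es : ℕ → ℝ) (x : Vec d) : ℝ :=
  (∫ v, psi τ v ^ 2 * jointHat L g h₀ hbar n xs es v x) /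
    ∫ v, jointHat L g h₀ hbar n xs es v x

/-- The supremum norm over `D`, with values in `[0, ∞]`. -/
def supNorm {d : ℕ} (D : Set (Vec d)) (f : Vec d → ℝ) : ℝ≥0∞ := ⨆ x ∈ D, ENNReal.ofReal |f x|

/-- `T_n = o_p^*(a_n)` almost surely: for almost every realization of the data,
`P*(T_n > δ a_n) → 0` for every `δ > 0`. -/
def IsLittleOStar {Ω : Type*} [MeasurableSpace Ω] (μ : Measure Ω) {S : ℕ → Type*}
    [∀ n, MeasurableSpace (S n)] (Pstar : (n : ℕ) → Ω → Measure (S n))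
    (T : (n : ℕ) → Ω → S n → ℝ≥0∞) (a : ℕ → ℝ) : Prop :=
  ∀ᵐ ω ∂μ, ∀ δ : ℝ, 0 < δ →
    Tendsto (fun n => Pstar n ω {z | ENNReal.ofReal (δ * a n) < T n ω z}) atTop (𝓝 0)

/-! ### The bootstrap limit theorem -/

/-- `A_n^*(x) = n⁻¹ ∑ K_h(x - X*_i) ψ_τ(ε*_i)`. -/
def aStar {d : ℕ} (τ : ℝ) (K : Vec d → ℝ) (h : ℝ) (n : ℕ) (z : Fin n → Vec d × ℝ)
    (x : Vec d) : ℝ :=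
  (n : ℝ)⁻¹ * ∑ i, scaled K h (x - (z i).1) * psi τ (z i).2

/-- `Shat_{n,0,0}(x) = 2 {τ - Fhat_{ε|X}(0|x) (2τ - 1)} fhat_X(x)`. -/
def sHat {d : ℕ} (τ : ℝ) (L : Vec d → ℝ) (G : ℝ → ℝ) (h₀ hbar : ℝ) (n : ℕ) (xs : ℕ → Vec d)
    (es : ℕ → ℝ) (x : Vec d) : ℝ :=
  2 * (τ - condCdfHat L G h₀ hbar n xs es 0 x * (2 * τ - 1)) * fXHat L hbar n xs x

/-- The one-step bootstrap deviation
`θ*(x) - θhat_n(x) = Shat_{n,0,0}(x)⁻¹ {A_n^*(x) - E*[A_n^*(x)]}`. -/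
def bootDev {d : ℕ} (τ : ℝ) (K : Vec d → ℝ) (h : ℝ) (L : Vec d → ℝ) (G g : ℝ → ℝ)
    (h₀ hbar : ℝ) (n : ℕ) (xs : ℕ → Vec d) (es : ℕ → ℝ) (z : Fin n → Vec d × ℝ)
    (x : Vec d) : ℝ :=
  (sHat τ L G h₀ hbar n xs es x)⁻¹ *
    (aStar τ K h n z x - ∫ z', aStar τ K h n z' x ∂(bootLaw L g h₀ hbar n xs es))

/-- `sup_{x ∈ D} r(x) |θ*(x) - θhat_n(x)|` with the scaling factor
`r(x) = √(n h^d / (fhat_X(x) V(x))) Shat_{n,0,0}(x)`, where `V` is the variance used for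
standardization. -/
def bootSup {d : ℕ} (τ : ℝ) (K : Vec d → ℝ) (h : ℝ) (L : Vec d → ℝ) (G g : ℝ → ℝ)
    (h₀ hbar : ℝ) (D : Set (Vec d)) (V : Vec d → ℝ) (n : ℕ) (xs : ℕ → Vec d) (es : ℕ → ℝ)
    (z : Fin n → Vec d × ℝ) : ℝ :=
  ⨆ x : D, Real.sqrt ((n : ℝ) * h ^ d / (fXHat L hbar n xs x * V x)) *
    sHat τ L G h₀ hbar n xs es x * |bootDev τ K h L G g h₀ hbar n xs es z x|

/-- `‖K‖₂`. -/
def l2norm {d : ℕ} (K : Vec d → ℝ) : ℝ := Real.sqrt (∫ u, K u ^ 2)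

/-- `Σ = (∫ ∂_i K ∂_j K)_{i,j}`. -/
def gradGram {d : ℕ} (K : Vec d → ℝ) : Matrix (Fin d) (Fin d) ℝ :=
  Matrix.of fun i j => ∫ u, fderiv ℝ K u (EuclideanSpace.single i 1) *
    fderiv ℝ K u (EuclideanSpace.single j 1)

/-- `H₂ = (2π ‖K‖₂²)^{-d/2} det(Σ)^{1/2}`. -/
def hTwo {d : ℕ} (K : Vec d → ℝ) : ℝ :=
  (2 * Real.pi * l2norm K ^ 2) ^ (-(d : ℝ) / 2) * Real.sqrt (gradGram K).det

/-- The centering sequence `d_n = (2dκ log n)^{1/2} + (2dκ log n)^{-1/2}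
[½ (d - 1) log log n^κ + log {(2π)^{-1/2} H₂ (2d)^{(d-1)/2}}]`. -/
def centering {d : ℕ} (K : Vec d → ℝ) (κ : ℝ) (n : ℕ) : ℝ :=
  Real.sqrt (2 * d * κ * Real.log n) + (Real.sqrt (2 * d * κ * Real.log n))⁻¹ *
    (1 / 2 * ((d : ℝ) - 1) * Real.log (Real.log ((n : ℝ) ^ κ)) +
      Real.log ((2 * Real.pi) ^ (-(1 : ℝ) / 2) * hTwo K * (2 * (d : ℝ)) ^ (((d : ℝ) - 1) / 2)))

/-- The bootstrap limit theorem along one realization of the data, standardized by the variance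
functions `V n`: for all `a`,
`P*{(2dκ log n)^{1/2} (sup_{x ∈ D} [r_n(x) |θ*(x) - θhat_n(x)|] / ‖K‖₂ - d_n) < a}
  → exp(-2 exp(-a))`. -/
def BootLimit {d : ℕ} (τ : ℝ) (K : Vec d → ℝ) (κ : ℝ) (h : ℕ → ℝ) (L : Vec d → ℝ) (G g : ℝ → ℝ)
    (h₀ hbar : ℕ → ℝ) (D : Set (Vec d)) (xs : ℕ → Vec d) (es : ℕ → ℕ → ℝ)
    (V : ℕ → Vec d → ℝ) : Prop :=
  ∀ a : ℝ, Tendsto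
    (fun n : ℕ => bootLaw L g (h₀ n) (hbar n) n xs (es n)
      {z | Real.sqrt (2 * d * κ * Real.log n) *
        (bootSup τ K (h n) L G g (h₀ n) (hbar n) D (V n) n xs (es n) z / l2norm K
          - centering K κ n) < a})
    atTop (𝓝 (ENNReal.ofReal (Real.exp (-2 * Real.exp (-a)))))

end ExpectileBoot

end

/-! Both conclusions rest on a deterministic bound, valid for every realization of the data.
Integrating the resampling density over `v` gives exactly `fXHat`, so the two variances share their
denominator; in the numerator each `ψ_τ²(ε̂_i)` is replaced by its average under `g` at scale `h₀`.
Since `ψ_τ²` has a Lipschitz derivative and symmetry of `g` kills the linear term, the difference is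
at most `8 h₀² ∫ v² g`, uniformly in `x` (`abs_sigmaStarSq_sub_sigmaHatSq_le`). Polynomial decay of
`h₀` makes this `o(1 / log n)`, so the bad events are eventually empty.

Where `σ̂² ≥ c`, this is a relative error `η_n = o(1 / log n)`, and the two suprema agree up to a
factor `1 + η_n`. At level `a` this moves the threshold by at most `η_n (a + √(2dκ log n) d_n)`. As
`√(2dκ log n) d_n` has order `log n`, the shift vanishes, and continuity of the Gumbel limit absorbs
it (`BootLimit.of_ratio`). -/

namespace ExpectileBoot

/-! ### Second-order expansion of the squared score -/

theorem psi_sq_of_nonpos {τ u : ℝ} (hu : u ≤ 0) : psi τ u ^ 2 = 4 * (1 - τ) ^ 2 * u ^ 2 := by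
  rw [psi, if_pos hu, mul_pow, sq_abs]; ring

theorem psi_sq_of_pos {τ u : ℝ} (hu : 0 < u) : psi τ u ^ 2 = 4 * τ ^ 2 * u ^ 2 := by
  rw [psi, if_neg hu.not_ge, mul_pow, sq_abs]; ring

/-- `ψ_τ²` has a Lipschitz derivative, hence a Taylor expansion with quadratic remainder. -/
theorem exists_psi_sq_expansion {τ : ℝ} (hτ : τ ∈ Set.Ioo (0 : ℝ) 1) (e : ℝ) :
    ∃ m : ℝ, ∀ w : ℝ, |psi τ (e - w) ^ 2 - psi τ e ^ 2 + m * w| ≤ 8 * w ^ 2 := by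
  obtain ⟨h0, h1⟩ := hτ
  have a1 : τ ^ 2 ≤ 1 := by nlinarith
  have a2 : (1 - τ) ^ 2 ≤ 1 := by nlinarith
  have a3 := sq_nonneg τ
  have a4 := sq_nonneg (1 - τ)
  generalize hp : τ ^ 2 = p at *
  generalize hq : (1 - τ) ^ 2 = q at *
  rcases le_or_gt e 0 with he | he
  -- The witness is the derivative of `ψ_τ²` at `e`.
  · refine ⟨8 * q * e, fun w => ?_⟩
    rw [psi_sq_of_nonpos he, hq]
    rcases le_or_gt (e - w) 0 with hw | hw
    · rw [psi_sq_of_nonpos hw, hq,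
        show 4 * q * (e - w) ^ 2 - 4 * q * e ^ 2 + 8 * q * e * w = 4 * q * w ^ 2 by ring,
        abs_of_nonneg (by positivity)]
      nlinarith [sq_nonneg w]
    · rw [psi_sq_of_pos hw, hp]
      -- Here `w < e ≤ 0`: the remainder crosses the kink and splits into two nonnegative pieces,
      -- each at most `4 w²`. This is where the constant 8 arises.
      have b1 : (e - w) ^ 2 ≤ w ^ 2 := by nlinarith
      have b2 : 0 ≤ 2 * e * w - e ^ 2 := by nlinarith
      have b3 : 2 * e * w - e ^ 2 ≤ w ^ 2 := by nlinarith [sq_nonneg (e - w)]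
      rw [show 4 * p * (e - w) ^ 2 - 4 * q * e ^ 2 + 8 * q * e * w
        = 4 * (p * (e - w) ^ 2) + 4 * (q * (2 * e * w - e ^ 2)) by ring,
        abs_of_nonneg (by positivity)]
      nlinarith [mul_le_mul a1 b1 (sq_nonneg _) zero_le_one, mul_le_mul a2 b3 b2 zero_le_one]
  · refine ⟨8 * p * e, fun w => ?_⟩
    rw [psi_sq_of_pos he, hp]
    rcases le_or_gt (e - w) 0 with hw | hw
    · rw [psi_sq_of_nonpos hw, hq]
      have b1 : (e - w) ^ 2 ≤ w ^ 2 := by nlinarith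
      have b2 : 0 ≤ 2 * e * w - e ^ 2 := by nlinarith
      have b3 : 2 * e * w - e ^ 2 ≤ w ^ 2 := by nlinarith [sq_nonneg (e - w)]
      rw [show 4 * q * (e - w) ^ 2 - 4 * p * e ^ 2 + 8 * p * e * w
        = 4 * (q * (e - w) ^ 2) + 4 * (p * (2 * e * w - e ^ 2)) by ring,
        abs_of_nonneg (by positivity)]
      nlinarith [mul_le_mul a2 b1 (sq_nonneg _) zero_le_one, mul_le_mul a1 b3 b2 zero_le_one]
    · rw [psi_sq_of_pos hw, hp,
        show 4 * p * (e - w) ^ 2 - 4 * p * e ^ 2 + 8 * p * e * w = 4 * p * w ^ 2 by ring,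
        abs_of_nonneg (by positivity)]
      nlinarith [sq_nonneg w]

theorem measurable_psi (τ : ℝ) : Measurable (psi τ) := by
  unfold psi
  exact ((measurable_const.mul ((Measurable.ite measurableSet_Iic measurable_const
    measurable_const).sub measurable_const)).mul measurable_norm)

/-! ### Smoothing by a symmetric density -/

section Smoothing

variable {g : ℝ → ℝ}

theorem integrable_id_mul_of_second_moment (g0 : ∀ v, 0 ≤ g v) (gi : Integrable g)
    (g2 : Integrable fun v => v ^ 2 * g v) : Integrable fun v => v * g v := by
  refine (gi.add g2).mono' (measurable_id.aestronglyMeasurable.mul gi.1) (.of_forall fun v => ?_)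
  rw [Real.norm_eq_abs, abs_mul, abs_of_nonneg (g0 v), Pi.add_apply, ← one_add_mul]
  refine mul_le_mul_of_nonneg_right ?_ (g0 v)
  nlinarith [sq_abs v, sq_nonneg (|v| - 1), abs_nonneg v]

theorem integral_id_mul_of_symm (gs : ∀ v, g (-v) = g v) : ∫ v, v * g v = 0 := by
  have h := integral_neg_eq_self (fun v => v * g v) volume
  simp only [gs, neg_mul, integral_neg] at h
  linarith

variable {τ : ℝ}

theorem integrable_psi_sq_sub_mul (hτ : τ ∈ Set.Ioo (0 : ℝ) 1) (g0 : ∀ v, 0 ≤ g v)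
    (gi : Integrable g) (g2 : Integrable fun v => v ^ 2 * g v) (e t : ℝ) :
    Integrable fun u => psi τ (e - t * u) ^ 2 * g u := by
  obtain ⟨m, hm⟩ := exists_psi_sq_expansion hτ e
  have g1 := integrable_id_mul_of_second_moment g0 gi g2
  refine (((gi.const_mul (psi τ e ^ 2)).add (g1.norm.const_mul |m * t|)).add
    (g2.const_mul (8 * t ^ 2))).mono' ?_ (.of_forall fun u => ?_)
  · exact (((measurable_psi τ).comp (by fun_prop : Measurable fun u : ℝ => e - t * u)).pow_const
      2).aestronglyMeasurable.mul gi.1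
  · have h1 : psi τ (e - t * u) ^ 2 ≤ psi τ e ^ 2 + |m * t| * |u| + 8 * t ^ 2 * u ^ 2 := by
      have := (abs_le.1 (hm (t * u))).2
      have h3 := neg_abs_le (m * t * u)
      rw [abs_mul (m * t)] at h3
      nlinarith
    rw [Real.norm_eq_abs, abs_of_nonneg (mul_nonneg (sq_nonneg _) (g0 u))]
    simp only [Pi.add_apply, norm_mul, Real.norm_eq_abs, abs_of_nonneg (g0 u)]
    calc _ ≤ _ := mul_le_mul_of_nonneg_right h1 (g0 u)
      _ = _ := by ring

/-- Smoothing by a symmetric density on scale `t` changes `ψ_τ²` by at most a multiple of `t²`,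
uniformly over the line. -/
theorem abs_integral_psi_sq_sub_le (hτ : τ ∈ Set.Ioo (0 : ℝ) 1) (g0 : ∀ v, 0 ≤ g v)
    (gi : Integrable g) (g2 : Integrable fun v => v ^ 2 * g v) (gs : ∀ v, g (-v) = g v)
    (g1 : ∫ v, g v = 1) (e t : ℝ) :
    |(∫ u, psi τ (e - t * u) ^ 2 * g u) - psi τ e ^ 2| ≤ 8 * t ^ 2 * ∫ v, v ^ 2 * g v := by
  obtain ⟨m, hm⟩ := exists_psi_sq_expansion hτ e
  have gl := integrable_id_mul_of_second_moment g0 gi g2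
  have hi := integrable_psi_sq_sub_mul hτ g0 gi g2 e t
  -- The linear term can be inserted for free because `g` has mean zero.
  have key : (∫ u, psi τ (e - t * u) ^ 2 * g u) - psi τ e ^ 2
      = ∫ u, (psi τ (e - t * u) ^ 2 - psi τ e ^ 2 + m * (t * u)) * g u := by
    have : ∀ u, (psi τ (e - t * u) ^ 2 - psi τ e ^ 2 + m * (t * u)) * g u
      = psi τ (e - t * u) ^ 2 * g u - psi τ e ^ 2 * g u + m * t * (u * g u) := fun u => by ring
    simp only [this]
    have hs : Integrable fun u => psi τ (e - t * u) ^ 2 * g u - psi τ e ^ 2 * g u :=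
      hi.sub (gi.const_mul _)
    rw [integral_add hs (gl.const_mul _), integral_sub hi (gi.const_mul _),
      integral_const_mul, integral_const_mul, g1, integral_id_mul_of_symm gs]
    ring
  rw [key, ← integral_const_mul, ← Real.norm_eq_abs]
  refine norm_integral_le_of_norm_le (g2.const_mul _) (.of_forall fun u => ?_)
  rw [norm_mul, Real.norm_eq_abs, Real.norm_eq_abs, abs_of_nonneg (g0 u)]
  calc _ ≤ _ := mul_le_mul_of_nonneg_right (hm (t * u)) (g0 u)
    _ = _ := by ring

variable {φ : ℝ → ℝ} {t : ℝ}

theorem integrable_mul_scaled (ht : 0 < t) (e : ℝ) (hi : Integrable fun u => φ (e - t * u) * g u) :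
    Integrable fun v => φ v * (t⁻¹ * g ((e - v) / t)) := by
  have h := ((hi.comp_mul_left' (inv_ne_zero ht.ne')).comp_sub_left e).const_mul t⁻¹
  refine h.congr (.of_forall fun v => ?_)
  simp only
  rw [mul_inv_cancel_left₀ ht.ne', sub_sub_cancel, div_eq_inv_mul]
  ring

theorem integral_mul_scaled (ht : 0 < t) (e : ℝ) :
    ∫ v, φ v * (t⁻¹ * g ((e - v) / t)) = ∫ u, φ (e - t * u) * g u := by
  rw [← integral_sub_left_eq_self _ volume e]
  have h := Measure.integral_comp_mul_left (fun w => φ (e - w) * (t⁻¹ * g ((e - (e - w)) / t))) t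
  rw [abs_of_pos (inv_pos.2 ht), smul_eq_mul, inv_mul_eq_div, eq_div_iff ht.ne'] at h
  rw [← h, mul_comm, ← integral_const_mul]
  refine integral_congr_ae (.of_forall fun u => ?_)
  simp only [sub_sub_cancel, mul_div_cancel_left₀ _ ht.ne']
  field_simp

end Smoothing

/-! ### Uniform comparison of the two variances -/

section Variance

variable {d : ℕ} {L : Vec d → ℝ} {G g : ℝ → ℝ}

/-- In `v`, the resampling density is a weighted sum of copies of `g` centred at the residuals.
Taking `φ = 1` yields the denominator of `σ_*²`, and `φ = ψ_τ²` its numerator. -/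
theorem integral_mul_jointHat {φ : ℝ → ℝ} {t : ℝ} (ht : 0 < t) (hbar : ℝ) (n : ℕ)
    (xs : ℕ → Vec d) (es : ℕ → ℝ) (x : Vec d)
    (hi : ∀ e, Integrable fun u => φ (e - t * u) * g u) :
    ∫ v, φ v * jointHat L g t hbar n xs es v x = (n : ℝ)⁻¹ * ∑ i ∈ Finset.range n,
      (∫ u, φ (es i - t * u) * g u) * scaled L hbar (x - xs i) := by
  have : ∀ v, φ v * jointHat L g t hbar n xs es v x = (n : ℝ)⁻¹ * ∑ i ∈ Finset.range n,
      φ v * (t⁻¹ * g ((es i - v) / t)) * scaled L hbar (x - xs i) := fun v => by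
    rw [jointHat, mul_left_comm, Finset.mul_sum]
    simp only [mul_assoc]
  simp only [this]
  rw [integral_const_mul, integral_finsetSum _ fun i _ =>
    (integrable_mul_scaled ht (es i) (hi _)).mul_const _]
  simp only [integral_mul_const, integral_mul_scaled ht]

theorem scaled_nonneg (hL : ∀ u, 0 ≤ L u) {t : ℝ} (ht : 0 < t) (u : Vec d) :
    0 ≤ scaled L t u := mul_nonneg (by positivity) (hL _)

theorem fXHat_nonneg (hL : ∀ u, 0 ≤ L u) {t : ℝ} (ht : 0 < t) (n : ℕ) (xs : ℕ → Vec d)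
    (x : Vec d) : 0 ≤ fXHat L t n xs x :=
  mul_nonneg (by positivity) (Finset.sum_nonneg fun _ _ => scaled_nonneg hL ht _)

/-- Over the common denominator, the difference is an average of smoothing errors with nonnegative
kernel weights, so the pointwise smoothing bound survives. -/
theorem abs_sigmaStarSq_sub_sigmaHatSq_le {τ : ℝ} (hτ : τ ∈ Set.Ioo (0 : ℝ) 1)
    (hB : KernelAssumption L G g) {t hbar : ℝ} (ht : 0 < t) (hbar0 : 0 < hbar) (n : ℕ)
    (xs : ℕ → Vec d) (es : ℕ → ℝ) (x : Vec d) :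
    |sigmaStarSq τ L g t hbar n xs es x - sigmaHatSq τ L hbar n xs es x|
      ≤ 8 * t ^ 2 * ∫ v, v ^ 2 * g v := by
  have hden : ∫ v, jointHat L g t hbar n xs es v x = fXHat L hbar n xs x := by
    have := integral_mul_jointHat (L := L) (g := g) (φ := fun _ => 1) ht hbar n xs es x
      fun e => by simpa using hB.g_integrable
    simpa [hB.g_integral, fXHat] using this
  have hM : 0 ≤ 8 * t ^ 2 * ∫ v, v ^ 2 * g v :=
    mul_nonneg (by positivity) (integral_nonneg fun v => mul_nonneg (sq_nonneg _) (hB.g_nonneg v))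
  have hf := fXHat_nonneg hB.L_nonneg hbar0 n xs x
  rw [sigmaStarSq, hden, sigmaHatSq, integral_mul_jointHat (φ := fun v => psi τ v ^ 2) ht hbar n xs
    es x (integrable_psi_sq_sub_mul hτ hB.g_nonneg hB.g_integrable hB.g_second_moment · t),
    ← sub_div, ← mul_sub, ← Finset.sum_sub_distrib, abs_div, abs_of_nonneg hf]
  -- Only `0 ≤ fXHat` is needed, so points with `0/0 = 0` are covered.
  refine div_le_of_le_mul₀ hf hM ?_
  rw [fXHat, mul_left_comm, abs_mul, abs_of_nonneg (by positivity : 0 ≤ (n : ℝ)⁻¹), Finset.mul_sum]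
  refine mul_le_mul_of_nonneg_left ((Finset.abs_sum_le_sum_abs _ _).trans
    (Finset.sum_le_sum fun i _ => ?_)) (by positivity)
  rw [← sub_mul, abs_mul, abs_of_nonneg (scaled_nonneg hB.L_nonneg hbar0 _)]
  exact mul_le_mul_of_nonneg_right (abs_integral_psi_sq_sub_le hτ hB.g_nonneg hB.g_integrable
    hB.g_second_moment hB.g_symm hB.g_integral _ _) (scaled_nonneg hB.L_nonneg hbar0 _)

end Variance

/-! ### Rates in `log n` -/

theorem BandwidthAssumption.tendsto_sq_mul_log {d : ℕ} {h₀ hbar : ℕ → ℝ}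
    (hB : BandwidthAssumption d h₀ hbar) :
    Tendsto (fun n : ℕ => h₀ n ^ 2 * Real.log n) atTop (𝓝 0) := by
  obtain ⟨ν, hν, hr, -⟩ := hB.rate
  have h1 : (fun n : ℕ => Real.log n) =o[atTop] fun n : ℕ => (n : ℝ) ^ (2 * ν) :=
    (isLittleO_log_rpow_atTop (by positivity)).comp_tendsto tendsto_natCast_atTop_atTop
  have h2 := (hr.pow 2).mul_isLittleO h1
  refine (isLittleO_one_iff ℝ).1 (h2.congr' .rfl ?_)
  filter_upwards [eventually_gt_atTop 0] with n hn
  have hn' : (0 : ℝ) < n := by exact_mod_cast hn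
  rw [← Real.rpow_natCast, ← Real.rpow_mul hn'.le, ← Real.rpow_add hn']
  norm_num
  ring_nf
  simp

theorem tendsto_log_natCast : Tendsto (fun n : ℕ => Real.log n) atTop atTop :=
  Real.tendsto_log_atTop.comp tendsto_natCast_atTop_atTop

/-- A perturbation of relative size `η_n = o(1 / log n)` is negligible against the centering. -/
theorem tendsto_mul_add_sqrt_mul_centering {d : ℕ} (hd : 1 ≤ d) (K : Vec d → ℝ) {κ : ℝ}
    (hκ : 0 < κ) {η : ℕ → ℝ} (hη : Tendsto (fun n : ℕ => η n * Real.log n) atTop (𝓝 0)) (a : ℝ) :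
    Tendsto (fun n : ℕ => η n * (a + Real.sqrt (2 * d * κ * Real.log n) * centering K κ n))
      atTop (𝓝 0) := by
  set c := Real.log ((2 * Real.pi) ^ (-(1 : ℝ) / 2) * hTwo K *
    (2 * (d : ℝ)) ^ (((d : ℝ) - 1) / 2)) with hc
  have hy : Tendsto (fun n : ℕ => κ * Real.log n) atTop atTop :=
    tendsto_log_natCast.const_mul_atTop hκ
  have hll : Tendsto (fun n : ℕ => Real.log (κ * Real.log n) / (κ * Real.log n)) atTop (𝓝 0) :=
    Real.isLittleO_log_id_atTop.tendsto_div_nhds_zero.comp hy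
  have hinv : Tendsto (fun n : ℕ => (Real.log n)⁻¹) atTop (𝓝 0) :=
    tendsto_inv_atTop_zero.comp tendsto_log_natCast
  -- With `log n` factored out, the bracket tends to the finite limit `2dκ`; the constant and the
  -- iterated logarithm drop out.
  have key := hη.mul (((hinv.const_mul (a + c)).add_const (2 * d * κ)).add
    (hll.const_mul (1 / 2 * ((d : ℝ) - 1) * κ)))
  rw [zero_mul] at key
  refine key.congr' ?_
  filter_upwards [tendsto_log_natCast.eventually_gt_atTop 0] with n hn
  have hd' : (0 : ℝ) < d := by exact_mod_cast hd
  have hr : 0 < 2 * d * κ * Real.log n := by positivity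
  have hlog : Real.log ((n : ℝ) ^ κ) = κ * Real.log n :=
    Real.log_rpow (Nat.cast_pos.2 (Nat.pos_of_ne_zero (by rintro rfl; simp at hn))) κ
  rw [centering, ← hc, hlog, mul_add (Real.sqrt _), Real.mul_self_sqrt hr.le,
    mul_inv_cancel_left₀ (Real.sqrt_pos.2 hr).ne']
  field_simp
  ring

/-! ### Stability of the limit theorem under a relative change of variance -/

/-- The reverse comparison `h2` is needed because an unbounded real supremum is `0` by convention:
it forces both families to be unbounded together. -/
theorem iSup_le_mul_iSup {ι : Type*} {f f' : ι → ℝ} {k : ℝ} (hk : 0 ≤ k) (h0 : ∀ i, 0 ≤ f' i)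
    (h1 : ∀ i, f i ≤ k * f' i) (h2 : ∀ i, f' i ≤ k * f i) : ⨆ i, f i ≤ k * ⨆ i, f' i := by
  by_cases hb : BddAbove (Set.range f')
  · exact Real.iSup_le (fun i => (h1 i).trans (mul_le_mul_of_nonneg_left (le_ciSup hb i) hk))
      (mul_nonneg hk (Real.iSup_nonneg h0))
  · have hb' : ¬ BddAbove (Set.range f) := fun ⟨M, hM⟩ => hb ⟨k * M, by
      rintro _ ⟨i, rfl⟩
      exact (h2 i).trans (mul_le_mul_of_nonneg_left (hM ⟨i, rfl⟩) hk)⟩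
    rw [Real.iSup_of_not_bddAbove hb, Real.iSup_of_not_bddAbove hb', mul_zero]

theorem sqrt_div_mul_le {A f V W η : ℝ} (hA : 0 ≤ A) (hf : 0 ≤ f) (hV : 0 < V) (hW : 0 < W)
    (hη : 0 ≤ η) (h : V ≤ (1 + η) * W) :
    Real.sqrt (A / (f * W)) ≤ (1 + η) * Real.sqrt (A / (f * V)) := by
  rw [← Real.sqrt_sq (by positivity : 0 ≤ 1 + η), ← Real.sqrt_mul (sq_nonneg _)]
  refine Real.sqrt_le_sqrt ?_
  -- Keeping `A / f` as one factor avoids assuming `f ≠ 0`.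
  rw [← div_div, ← div_div, ← mul_div_assoc, div_le_div_iff₀ hW hV]
  have : V ≤ (1 + η) ^ 2 * W := by
    nlinarith [mul_nonneg (mul_nonneg hη hη) hW.le, mul_nonneg hη hW.le]
  calc A / f * V ≤ A / f * ((1 + η) ^ 2 * W) := mul_le_mul_of_nonneg_left this (div_nonneg hA hf)
    _ = _ := by ring

section

variable {d : ℕ} {L : Vec d → ℝ} {G g : ℝ → ℝ}

theorem sHat_nonneg {τ : ℝ} (hτ : τ ∈ Set.Ioo (0 : ℝ) 1) (hB : KernelAssumption L G g) {t hbar : ℝ}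
    (hbar0 : 0 < hbar) (n : ℕ) (xs : ℕ → Vec d) (es : ℕ → ℝ) (x : Vec d) :
    0 ≤ sHat τ L G t hbar n xs es x := by
  have hG0 : ∀ v, 0 ≤ G v := hB.G_mono.le_of_tendsto hB.G_atBot
  have hG1 : ∀ v, G v ≤ 1 := hB.G_mono.ge_of_tendsto hB.G_atTop
  have hf := fXHat_nonneg hB.L_nonneg hbar0 n xs x
  have hs := fun i => scaled_nonneg hB.L_nonneg hbar0 (x - xs i)
  have hF0 : 0 ≤ condCdfHat L G t hbar n xs es 0 x :=
    div_nonneg (mul_nonneg (by positivity)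
      (Finset.sum_nonneg fun i _ => mul_nonneg (hG0 _) (hs i))) hf
  have hF1 : condCdfHat L G t hbar n xs es 0 x ≤ 1 :=
    div_le_one_of_le₀ (mul_le_mul_of_nonneg_left (Finset.sum_le_sum fun i _ =>
      mul_le_of_le_one_left (hs i) (hG1 _)) (by positivity)) hf
  refine mul_nonneg (mul_nonneg zero_le_two ?_) hf
  -- `τ - F (2τ - 1) = τ (1 - F) + (1 - τ) F`.
  nlinarith [mul_nonneg hτ.1.le (sub_nonneg.2 hF1), mul_nonneg (sub_nonneg.2 hτ.2.le) hF0]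

theorem bootSup_le_mul_bootSup {τ : ℝ} (hτ : τ ∈ Set.Ioo (0 : ℝ) 1) (hB : KernelAssumption L G g)
    (K : Vec d → ℝ) {h t hbar η : ℝ} (hh : 0 < h) (hbar0 : 0 < hbar) (hη : 0 ≤ η) {D : Set (Vec d)}
    {V W : Vec d → ℝ} (hV : ∀ x ∈ D, 0 < V x) (hW : ∀ x ∈ D, 0 < W x)
    (hVW : ∀ x ∈ D, V x ≤ (1 + η) * W x) (hWV : ∀ x ∈ D, W x ≤ (1 + η) * V x)
    (n : ℕ) (xs : ℕ → Vec d) (es : ℕ → ℝ) (z : Fin n → Vec d × ℝ) :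
    bootSup τ K h L G g t hbar D V n xs es z
      ≤ (1 + η) * bootSup τ K h L G g t hbar D W n xs es z := by
  have hA : 0 ≤ (n : ℝ) * h ^ d := by positivity
  have hf := fXHat_nonneg hB.L_nonneg hbar0 n xs
  have hS := sHat_nonneg hτ hB hbar0 (t := t) n xs es
  refine iSup_le_mul_iSup (by positivity)
    (fun x => mul_nonneg (mul_nonneg (Real.sqrt_nonneg _) (hS x)) (abs_nonneg _))
    (fun x => ?_) (fun x => ?_)
  · rw [← mul_assoc, ← mul_assoc]
    exact mul_le_mul_of_nonneg_right (mul_le_mul_of_nonneg_right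
      (sqrt_div_mul_le hA (hf x) (hW x x.2) (hV x x.2) hη (hWV x x.2)) (hS x)) (abs_nonneg _)
  · rw [← mul_assoc, ← mul_assoc]
    exact mul_le_mul_of_nonneg_right (mul_le_mul_of_nonneg_right
      (sqrt_div_mul_le hA (hf x) (hV x x.2) (hW x x.2) hη (hVW x x.2)) (hS x)) (abs_nonneg _)

/-- If two families of sets `A n b`, `B n b` interlace up to arbitrarily small shifts of `b`, then
convergence to a continuous limit carries over from `A` to `B`. -/
theorem tendsto_measure_of_interlace {S : ℕ → Type*} [∀ n, MeasurableSpace (S n)]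
    (P : ∀ n, Measure (S n)) {A B : ∀ n, ℝ → Set (S n)} {F : ℝ → ℝ≥0∞} (hF : Continuous F)
    (hA : ∀ a, Tendsto (fun n => P n (A n a)) atTop (𝓝 (F a)))
    (hAB : ∀ a δ, 0 < δ → ∀ᶠ n in atTop, A n a ⊆ B n (a + δ))
    (hBA : ∀ a δ, 0 < δ → ∀ᶠ n in atTop, B n a ⊆ A n (a + δ)) (a : ℝ) :
    Tendsto (fun n => P n (B n a)) atTop (𝓝 (F a)) := by
  refine tendsto_order.2 ⟨fun l hl => ?_, fun u hu => ?_⟩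
  · have h1 := ((hF.tendsto a).eventually_const_lt hl).filter_mono
      (nhdsWithin_le_nhds (s := Set.Iio a))
    -- Continuity of `F` gives `b < a` with `l < F b`; the gap `a - b` is the shift spent on
    -- interlacing.
    obtain ⟨b, hb, hba⟩ := (h1.and self_mem_nhdsWithin).exists
    filter_upwards [(hA b).eventually_const_lt hb, hAB b (a - b) (sub_pos.2 hba)] with n h2 h3
    rw [add_sub_cancel] at h3
    exact h2.trans_le (measure_mono h3)
  · have h1 := ((hF.tendsto a).eventually_lt_const hu).filter_mono
      (nhdsWithin_le_nhds (s := Set.Ioi a))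
    obtain ⟨b, hb, hba⟩ := (h1.and self_mem_nhdsWithin).exists
    filter_upwards [(hA b).eventually_lt_const hb, hBA a (b - a) (sub_pos.2 hba)] with n h2 h3
    rw [add_sub_cancel] at h3
    exact (measure_mono h3).trans_lt h2

/-- The extra term is `η r T`, and `r T < a + r c`. -/
theorem mul_sub_lt_of_le_mul {r c S T η a δ : ℝ} (hr : 0 ≤ r) (hη : 0 ≤ η) (hST : S ≤ (1 + η) * T)
    (hδ : η * (a + r * c) < δ) (hT : r * (T - c) < a) : r * (S - c) < a + δ := by
  nlinarith [mul_le_mul_of_nonneg_left hST hr, mul_le_mul_of_nonneg_left hT.le hη]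

/-- The bootstrap limit theorem is insensitive to a relative change of order `o(1 / log n)` of the
standardizing variance. -/
theorem BootLimit.of_ratio {τ : ℝ} (hd : 1 ≤ d) (hτ : τ ∈ Set.Ioo (0 : ℝ) 1)
    (hB : KernelAssumption L G g) {K : Vec d → ℝ} {κ : ℝ} (hκ : 0 < κ) {h h₀ hbar η : ℕ → ℝ}
    (hh : ∀ n, 0 < h n) (hbar0 : ∀ n, 0 < hbar n) (hη0 : ∀ n, 0 ≤ η n)
    (hη : Tendsto (fun n : ℕ => η n * Real.log n) atTop (𝓝 0)) {D : Set (Vec d)}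
    {xs : ℕ → Vec d} {es : ℕ → ℕ → ℝ} {V W : ℕ → Vec d → ℝ}
    (hVW : ∀ᶠ n in atTop, ∀ x ∈ D, 0 < V n x ∧ 0 < W n x ∧ V n x ≤ (1 + η n) * W n x ∧
      W n x ≤ (1 + η n) * V n x)
    (hlim : BootLimit τ K κ h L G g h₀ hbar D xs es V) :
    BootLimit τ K κ h L G g h₀ hbar D xs es W := by
  have step : ∀ {V W : ℕ → Vec d → ℝ}, (∀ᶠ n in atTop, ∀ x ∈ D, 0 < V n x ∧ 0 < W n x ∧
      V n x ≤ (1 + η n) * W n x ∧ W n x ≤ (1 + η n) * V n x) → ∀ a δ : ℝ, 0 < δ →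
      ∀ᶠ n : ℕ in atTop, {z | Real.sqrt (2 * d * κ * Real.log n) *
        (bootSup τ K (h n) L G g (h₀ n) (hbar n) D (V n) n xs (es n) z / l2norm K
          - centering K κ n) < a} ⊆ {z | Real.sqrt (2 * d * κ * Real.log n) *
        (bootSup τ K (h n) L G g (h₀ n) (hbar n) D (W n) n xs (es n) z / l2norm K
          - centering K κ n) < a + δ} := by
    intro V W hVW a δ hδ
    filter_upwards [hVW, (tendsto_mul_add_sqrt_mul_centering hd K hκ hη a).eventually_lt_const hδ]
      with n hn hn' z hz
    refine mul_sub_lt_of_le_mul (Real.sqrt_nonneg _) (hη0 n) ?_ hn' hz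
    rw [← mul_div_assoc]
    exact div_le_div_of_nonneg_right (bootSup_le_mul_bootSup hτ hB K (hh n) (hbar0 n) (hη0 n)
      (fun x hx => (hn x hx).2.1) (fun x hx => (hn x hx).1) (fun x hx => (hn x hx).2.2.2)
      (fun x hx => (hn x hx).2.2.1) n xs (es n) z) (Real.sqrt_nonneg _)
  exact tendsto_measure_of_interlace (fun n => bootLaw L g (h₀ n) (hbar n) n xs (es n))
    (ENNReal.continuous_ofReal.comp (by fun_prop)) hlim (step hVW)
    (step (hVW.mono fun n hn x hx => ⟨(hn x hx).2.1, (hn x hx).1, (hn x hx).2.2.2, (hn x hx).2.2.1⟩))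

/-- Both numbers are at least `c / 2`, so an additive error `e` is a relative error of at most `e /
(c / 2)` against either. -/
theorem ratio_bounds_of_abs_sub_le {v w c e : ℝ} (hc : 0 < c) (hw : c ≤ w) (h : |v - w| ≤ e)
    (hec : e < c / 2) :
    0 < v ∧ 0 < w ∧ v ≤ (1 + e / (c / 2)) * w ∧ w ≤ (1 + e / (c / 2)) * v := by
  have he : 0 ≤ e := (abs_nonneg _).trans h
  obtain ⟨h1, h2⟩ := abs_le.1 h
  have key : ∀ y, c / 2 ≤ y → e ≤ e / (c / 2) * y := fun y hy => by
    rw [div_mul_eq_mul_div, le_div_iff₀ (half_pos hc)]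
    exact mul_le_mul_of_nonneg_left hy he
  have kv := key v (by linarith)
  have kw := key w (by linarith)
  refine ⟨?_, ?_, ?_, ?_⟩ <;> linarith

theorem lt_mul_rpow_of_mul_lt {e l δ : ℝ} (he : 0 ≤ e) (hl : 1 ≤ l) (h : e * l < δ) :
    e < δ * l ^ (-(1 : ℝ) / 2) := by
  have hl0 : 0 < l := one_pos.trans_le hl
  refine lt_of_le_of_lt ?_ (mul_lt_mul_of_pos_right h (Real.rpow_pos_of_pos hl0 _))
  rw [mul_assoc]
  refine le_mul_of_one_le_right he ?_
  nth_rw 1 [← Real.rpow_one l]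
  rw [← Real.rpow_add hl0]
  exact Real.one_le_rpow hl (by norm_num)

end

end ExpectileBoot

theorem lemma3p2 {d : ℕ} (hd : 1 ≤ d) {Ω : Type*} [MeasurableSpace Ω] (μ : Measure Ω)
    [IsProbabilityMeasure μ] (τ : ℝ) (hτ : τ ∈ Set.Ioo (0 : ℝ) 1)
    (X : ℕ → Ω → ExpectileBoot.Vec d) (Y : ℕ → Ω → ℝ) (θ₀ : ExpectileBoot.Vec d → ℝ)
    (fX : ExpectileBoot.Vec d → ℝ) (fε : ℝ → ExpectileBoot.Vec d → ℝ)
    (hmodel : ExpectileBoot.IsExpectileModel μ τ X Y θ₀ fX fε)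
    (K : ExpectileBoot.Vec d → ℝ) (hK : Integrable K) (hK1 : ∫ u, K u = 1)
    (h : ℕ → ℝ) (hh : ∀ n, 0 < h n)
    (θhat : ℕ → Ω → ExpectileBoot.Vec d → ℝ)
    (hθhat : ExpectileBoot.IsLocalExpectile τ K h X Y θhat)
    (D : Set (ExpectileBoot.Vec d)) (hD : IsCompact D)
    (L : ExpectileBoot.Vec d → ℝ) (G g : ℝ → ℝ) (h₀ hbar : ℕ → ℝ) (s' b : ℝ)
    (hB1 : ExpectileBoot.KernelAssumption L G g)
    (hB2 : ExpectileBoot.SmoothnessAssumption τ s' D fX fε)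
    (hB3 : ExpectileBoot.BandwidthAssumption d h₀ hbar)
    (hEC1 : ExpectileBoot.MomentAssumption b D fε)
    (hb : 2 * (2 * s' + d + 1) / (2 * s' + 3) < b) :
    ExpectileBoot.IsLittleOStar μ
      (fun n ω => ExpectileBoot.bootLaw L g (h₀ n) (hbar n) n (fun i => X i ω)
        (ExpectileBoot.resid X Y θhat n ω))
      (fun n ω _ => ExpectileBoot.supNorm D (fun x =>
        ExpectileBoot.sigmaStarSq τ L g (h₀ n) (hbar n) n (fun i => X i ω)
            (ExpectileBoot.resid X Y θhat n ω) x
          - ExpectileBoot.sigmaHatSq τ L (hbar n) n (fun i => X i ω)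
            (ExpectileBoot.resid X Y θhat n ω) x))
      (fun n => Real.log n ^ (-(1 : ℝ) / 2)) ∧
    (ContDiff ℝ 1 K → HasCompactSupport K → ∀ κ : ℝ, 0 < κ →
      ∀ᵐ ω ∂μ, ∀ c : ℝ, 0 < c →
        (∀ᶠ n in atTop, ∀ x ∈ D, c ≤ ExpectileBoot.sigmaHatSq τ L (hbar n) n (fun i => X i ω)
            (ExpectileBoot.resid X Y θhat n ω) x) →
        (ExpectileBoot.BootLimit τ K κ h L G g h₀ hbar D (fun i => X i ω)
            (fun n => ExpectileBoot.resid X Y θhat n ω)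
            (fun n => ExpectileBoot.sigmaStarSq τ L g (h₀ n) (hbar n) n (fun i => X i ω)
              (ExpectileBoot.resid X Y θhat n ω)) ↔
          ExpectileBoot.BootLimit τ K κ h L G g h₀ hbar D (fun i => X i ω)
            (fun n => ExpectileBoot.resid X Y θhat n ω)
            (fun n => ExpectileBoot.sigmaHatSq τ L (hbar n) n (fun i => X i ω)
              (ExpectileBoot.resid X Y θhat n ω)))) := by
  have hM : 0 ≤ ∫ v, v ^ 2 * g v :=
    integral_nonneg fun v => mul_nonneg (sq_nonneg v) (hB1.g_nonneg v)
  have hbound := fun (n : ℕ) (ω : Ω) (x : ExpectileBoot.Vec d) =>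
    ExpectileBoot.abs_sigmaStarSq_sub_sigmaHatSq_le hτ hB1 (hB3.h₀_pos n) (hB3.hbar_pos n) n
      (fun i => X i ω) (ExpectileBoot.resid X Y θhat n ω) x
  set e : ℕ → ℝ := fun n => 8 * h₀ n ^ 2 * ∫ v, v ^ 2 * g v with he
  have he0 : ∀ n, 0 ≤ e n := fun n => by positivity
  have helog : Tendsto (fun n : ℕ => e n * Real.log n) atTop (𝓝 0) := by
    have := hB3.tendsto_sq_mul_log.const_mul (8 * ∫ v, v ^ 2 * g v)
    rw [mul_zero] at this
    exact this.congr fun n => by ring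
  have hlog1 := ExpectileBoot.tendsto_log_natCast.eventually_ge_atTop 1
  refine ⟨.of_forall fun ω δ hδ => ?_, fun _ _ κ hκ => .of_forall fun ω c hc hlow => ?_⟩
  · refine tendsto_const_nhds.congr' ?_
    filter_upwards [helog.eventually_lt_const hδ, hlog1] with n hn hl
    -- The statistic does not depend on the bootstrap sample, so for large `n` the event is empty.
    refine (measure_mono_null (fun z hz => ?_) measure_empty).symm
    refine (not_lt_of_ge ?_ (Set.mem_ofPred.1 hz)).elim
    exact iSup₂_le fun x _ => ENNReal.ofReal_le_ofReal
      ((hbound n ω x).trans (ExpectileBoot.lt_mul_rpow_of_mul_lt (he0 n) hl hn).le)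
  · have hη0 : ∀ n, 0 ≤ e n / (c / 2) := fun n => div_nonneg (he0 n) (by positivity)
    have hη : Tendsto (fun n : ℕ => e n / (c / 2) * Real.log n) atTop (𝓝 0) := by
      have := helog.div_const (c / 2)
      rw [zero_div] at this
      exact this.congr fun n => by ring
    have hev : ∀ᶠ n : ℕ in atTop, e n < c / 2 := by
      filter_upwards [helog.eventually_lt_const (half_pos hc), hlog1] with n hn hl
      exact (le_mul_of_one_le_right (he0 n) hl).trans_lt hn
    have hratio := (hlow.and hev).mono fun n hn x (hx : x ∈ D) =>
      ExpectileBoot.ratio_bounds_of_abs_sub_le hc (hn.1 x hx) (hbound n ω x) hn.2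
    exact ⟨.of_ratio hd hτ hB1 hκ hh hB3.hbar_pos hη0 hη hratio,
      .of_ratio hd hτ hB1 hκ hh hB3.hbar_pos hη0 hη
        (hratio.mono fun n hn x hx =>
          ⟨(hn x hx).2.1, (hn x hx).1, (hn x hx).2.2.2, (hn x hx).2.2.1⟩)⟩
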